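/- Let $F \neq \mathbb{Q}$ be a number field of degree $d$ with ring of integers $\mathcal{O}_F$ and discriminant $D_F$, and let $\Sigma$ be the set of field embeddings $\sigma : F \to \mathbb{C}$. Identify $F_{\mathbb{R}} = \mathbb{R} \otimes_{\mathbb{Q}} F$ with $\{(x_\sigma) \in \mathbb{C}^\Sigma : \overline{x_{\overline\sigma}} = x_\sigma \text{ for all } \sigma\}$, with component-wise complex conjugation $x \mapsto \overline{x}$ and trace $\mathrm{Tr}(x) = \sum_{\sigma} x_\sigma \in \mathbb{R}$. Let $L$ be a free $\mathcal{O}_F$-module of finite rank $N \geq 5$, let $V = F \otimes_{\mathcal{O}_F} L$ and $V_{\mathbb{R}} = \mathbb{R} \otimes_{\mathbb{Q}} V$, an $F_{\mathbb{R}}$-module containing $L$. Let $h = (h_\sigma)_{\sigma\in\Sigma} : V_{\mathbb{R}} \times V_{\mathbb{R}} \to F_{\mathbb{R}}$ be a positive definite hermitian form: $h$ is additive and $F_{\mathbb{R}}$-linear in the first variable, $h(y,x) = \overline{h(x,y)}$, $h_\sigma(x,x) \geq 0$ for all $x \in V_{\mathbb{R}}$ and $\sigma \in \Sigma$, and $h(x,x)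 \neq 0$ for $x \neq 0$ (equivalently, each $h_\sigma$ is positive definite on the $\sigma$-component of $V_{\mathbb{R}}$). Put $q_h(x) = \mathrm{Tr}(h(x,x))$ and $\|x\|_h = \sqrt{q_h(x)}$, let $m(L,h)$ be the minimum of $q_h$ on the nonzero elements of $L$, and let $M(L,h) = \{x \in L : q_h(x) = m(L,h)\}$. Suppose that $(L,h)$ is well rounded, that is, $m(L,h) = 1$ and $M(L,h)$ generates $V$ as a vector space over $F$. Let $$B = \frac{4N^2}{2^N}\, d^{\,5Nd^2}\, |D_F|^{6N(d+1)}, \qquad T = N^{Nd}\, d^{\frac32 Nd + 1}\, B^{2(Nd-1)}\, |D_F|^{2N},$$ and let $e_1, \dots, e_N$ be any basis of $L$ over $\mathcal{O}_F$ with $\|e_i\|_h \leq B$ for $i = 1, \dots, N$. Then for every $x \in M(L,h)$, written as $x = \sum_i x_i e_i$ with $x_i \in \mathcal{O}_F$, and every $i = 1, \dots, N$, we have $$\sum_{\sigma \in \Sigma} |\sigma(x_i)|^2 \leq T.$$ -/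

import Mathlib

open scoped NumberField TensorProduct

noncomputable section

namespace HermLat

/-- `F_ℝ = ℝ ⊗_ℚ F`, realised as the real algebra `(ℂ^Σ)⁺`, where `Σ` is the set of field
embeddings `σ : F → ℂ`: the elements `x = (x_σ)` of `ℂ^Σ` that are invariant under the involution
sending `x` to the family whose `σ`-component is the complex conjugate of `x_{σ̄}`.
Its `star` is the component-wise complex conjugation. -/
def realSpace (F : Type*) [Field F] : StarSubalgebra ℝ ((F →+* ℂ) → ℂ) where
  carrier := {x | ∀ σ : F →+* ℂ, star (x (NumberField.ComplexEmbedding.conjugate σ)) = x σ}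
  mul_mem' := by
    intro a b ha hb σ
    simp only [Pi.mul_apply, star_mul', ha σ, hb σ]
  add_mem' := by
    intro a b ha hb σ
    simp only [Pi.add_apply, star_add, ha σ, hb σ]
  algebraMap_mem' := by
    intro r σ
    simp
  star_mem' := by
    intro a ha σ
    simp only [Pi.star_apply, ha σ]

/-- The diagonal embedding `F → F_ℝ`, `a ↦ (σ(a))_σ`. -/
def diag (F : Type*) [Field F] : F →+* realSpace F where
  toFun a := ⟨fun σ => σ a, fun σ => by simp⟩
  map_one' := by ext σ; simp
  map_mul' a b := by ext σ; simp
  map_zero' := by ext σ; simp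
  map_add' a b := by ext σ; simp

instance instAlgebraRealSpace (F : Type*) [Field F] : Algebra F (realSpace F) :=
  (diag F).toAlgebra

/-- The trace `Tr : F_ℝ → ℝ`, `Tr(x) = ∑_σ x_σ`. This sum is a real number for `x ∈ F_ℝ`,
so taking its real part only changes the type. -/
def trace {F : Type*} [Field F] [NumberField F] (x : realSpace F) : ℝ :=
  (∑ σ : F →+* ℂ, (x : (F →+* ℂ) → ℂ) σ).re

/-- `V = F ⊗_{𝓞_F} L`. -/
abbrev rationalSpan (F : Type*) [Field F] (L : Type*) [AddCommGroup L] [Module (𝓞 F) L] :=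
  F ⊗[𝓞 F] L

/-- `V_ℝ = ℝ ⊗_ℚ V = F_ℝ ⊗_F V`, an `F_ℝ`-module. -/
abbrev realSpan (F : Type*) [Field F] (L : Type*) [AddCommGroup L] [Module (𝓞 F) L] :=
  realSpace F ⊗[F] rationalSpan F L

/-- The canonical map `L → V`. -/
def toV (F : Type*) [Field F] {L : Type*} [AddCommGroup L] [Module (𝓞 F) L] (x : L) :
    rationalSpan F L :=
  (1 : F) ⊗ₜ[𝓞 F] x

/-- The canonical map `L → V → V_ℝ`. -/
def toVR (F : Type*) [Field F] {L : Type*} [AddCommGroup L] [Module (𝓞 F) L] (x : L) :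
    realSpan F L :=
  (1 : realSpace F) ⊗ₜ[F] toV F x

/-- A positive definite hermitian form `h : V_ℝ × V_ℝ → F_ℝ`: it is additive and `F_ℝ`-linear in
the first variable, `h(y, x)` is the conjugate of `h(x, y)`, every `h_σ(x, x)` (a real number) is
nonnegative, and `h(x, x) ≠ 0` for `x ≠ 0`. Since `V_ℝ` is the product of its components over the
archimedean places, the last two conditions say that each `h_σ` is positive definite on the
component of `V_ℝ` on which it lives. (One cannot ask `h_σ(x, x) > 0` for all `x ≠ 0` in `V_ℝ`,
as `h_σ(x, x) = 0` whenever `x` has zero component at `σ`.) -/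
structure PosDefHermitianForm (F : Type*) [Field F] (L : Type*) [AddCommGroup L]
    [Module (𝓞 F) L] where
  form : realSpan F L → realSpan F L → realSpace F
  add_left : ∀ x y z, form (x + y) z = form x z + form y z
  smul_left : ∀ (a : realSpace F) (x y), form (a • x) y = a * form x y
  conj_symm : ∀ x y, form y x = star (form x y)
  nonneg : ∀ x (σ : F →+* ℂ), 0 ≤ ((form x x : (F →+* ℂ) → ℂ) σ).re
  definite : ∀ x, form x x = 0 → x = 0

section

variable {F : Type*} [Field F] [NumberField F] {L : Type*} [AddCommGroup L] [Module (𝓞 F) L]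

/-- The real quadratic form `q_h(x) = Tr(h(x, x))` on `V_ℝ`. -/
def quadForm (h : PosDefHermitianForm F L) (x : realSpan F L) : ℝ :=
  trace (h.form x x)

/-- The norm `‖x‖_h` on `V_ℝ` induced by `q_h`. -/
def hnorm (h : PosDefHermitianForm F L) (x : realSpan F L) : ℝ :=
  Real.sqrt (quadForm h x)

/-- `m(L, h)`, the minimum of `q_h` on the nonzero elements of `L`. -/
def minValue (h : PosDefHermitianForm F L) : ℝ :=
  sInf {r : ℝ | ∃ x : L, x ≠ 0 ∧ r = quadForm h (toVR F x)}

/-- `M(L, h)`, the set of minimal vectors of `L`. -/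
def minVectors (h : PosDefHermitianForm F L) : Set L :=
  {x : L | quadForm h (toVR F x) = minValue h}

/-- `(L, h)` is well rounded: `m(L, h) = 1` and `M(L, h)` generates the `F`-vector space `V`. -/
def IsWellRounded (h : PosDefHermitianForm F L) : Prop :=
  minValue h = 1 ∧ Submodule.span F (toV F '' minVectors h) = ⊤

end

/-- `B = (4 N² / 2^N) d^{5 N d²} |D_F|^{6 N (d + 1)}`, where `d = [F : ℚ]`. -/
def boundB (F : Type*) [Field F] [NumberField F] (N : ℕ) : ℝ :=
  4 * (N : ℝ) ^ 2 / 2 ^ N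
    * (Module.finrank ℚ F : ℝ) ^ (5 * N * Module.finrank ℚ F ^ 2)
    * |(NumberField.discr F : ℝ)| ^ (6 * N * (Module.finrank ℚ F + 1))

/-- `T = N^{N d} d^{(3/2) N d + 1} B^{2 (N d - 1)} |D_F|^{2 N}`, where `d = [F : ℚ]`; the exponent
of `d` is real, and the subtraction in the exponent of `B` is exact as soon as `N ≥ 1`. -/
def boundT (F : Type*) [Field F] [NumberField F] (N : ℕ) : ℝ :=
  (N : ℝ) ^ (N * Module.finrank ℚ F)
    * (Module.finrank ℚ F : ℝ) ^ ((3 / 2 : ℝ) * N * Module.finrank ℚ F + 1)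
    * boundB F N ^ (2 * (N * Module.finrank ℚ F - 1))
    * |(NumberField.discr F : ℝ)| ^ (2 * N)

end HermLat

end

/-! Let `H σ` be the Gram matrix of `e` for the component `h_σ`, and let `P` be the product of all
`det (H σ)`. Cramer's rule combined with Hadamard's inequality gives `|σ(x_i)|² det (H σ) ≤ h_σ(x,x)
∏_{j≠i} H σ j j ≤ B^(2(N-1))`, because `h_σ(x,x) ≤ q_h(x) = 1`. Hadamard also gives `det (H τ) ≤
B^(2N)` for the other `d - 1` embeddings, so `|σ(x_i)|² P ≤ B^(2(Nd-1))`.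

It remains to bound `P` from below. The Gram matrix of `q_h` on a `ℤ`-basis `ω_κ e_i` of `L` has
determinant `|D_F|^N P`. Since `q_h ≥ 1` on nonzero lattice vectors, Minkowski's theorem for a cube
makes this at least `(Nd)^(-Nd)`. Summing over the `d` embeddings gives a bound slightly sharper
than `T`. -/

/-! ### Determinant inequalities for positive semidefinite matrices -/

open scoped ComplexOrder in
/-- Hadamard's inequality. -/
theorem Matrix.PosSemidef.re_det_le_prod_re_diag {n : Type*} [Fintype n] [DecidableEq n]
    {A : Matrix n n ℂ} (hA : A.PosSemidef) : A.det.re ≤ ∏ i, (A i i).re := by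
  have hdiag : ∀ i, 0 ≤ (A i i).re := fun i => (Complex.le_def.1 (hA.diag_nonneg (i := i))).1
  by_cases h0 : A.det = 0
  · rw [h0]; exact Finset.prod_nonneg fun i _ => hdiag i
  have hpd : A.PosDef := hA.posDef_iff_det_ne_zero.2 h0
  have hpos : ∀ i, 0 < (A i i).re := fun i => (Complex.lt_def.1 (hpd.diag_pos (i := i))).1
  have him : ∀ i, A i i = ((A i i).re : ℂ) := fun i => by
    apply Complex.ext <;> simp [← (Complex.le_def.1 (hA.diag_nonneg (i := i))).2]
  -- Rescaling to unit diagonal makes the eigenvalues sum to `n`; then `λ ≤ exp (λ - 1)` bounds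
  -- their product by `1`.
  set D : Matrix n n ℂ := Matrix.diagonal fun i => (((√(A i i).re)⁻¹ : ℝ) : ℂ) with hD
  have hDs : D.conjTranspose = D := by
    rw [hD, Matrix.diagonal_conjTranspose]
    congr 1
    ext i
    simp
  have hB : (D * A * D.conjTranspose).PosSemidef := hA.mul_mul_conjTranspose_same D
  have hBii : ∀ i, (D * A * D.conjTranspose) i i = 1 := fun i => by
    rw [hDs, hD, Matrix.mul_diagonal, Matrix.diagonal_mul, him i, ← Complex.ofReal_mul,
      ← Complex.ofReal_mul, ← Complex.ofReal_one]
    congr 1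
    have := Real.mul_self_sqrt (hpos i).le
    have h2 : √(A i i).re ≠ 0 := (Real.sqrt_pos.2 (hpos i)).ne'
    simp only [Complex.ofReal_re]
    field_simp
    linarith [sq (√(A i i).re)]
  have htr : ∑ i, (hB.1.eigenvalues i - 1) = 0 := by
    have h1 := hB.1.trace_eq_sum_eigenvalues
    simp only [Matrix.trace, Matrix.diag_apply, hBii] at h1
    rw [Finset.sum_sub_distrib, sub_eq_zero]
    have h2 := congrArg Complex.re h1
    simpa using h2.symm
  have hle : (D * A * D.conjTranspose).det.re ≤ 1 := by
    rw [hB.1.det_eq_prod_eigenvalues]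
    have : (∏ i, ((hB.1.eigenvalues i : ℝ) : ℂ)).re = ∏ i, hB.1.eigenvalues i := by
      rw [← Complex.ofReal_prod, Complex.ofReal_re]
    refine this.trans_le ?_
    calc ∏ i, hB.1.eigenvalues i ≤ ∏ i, Real.exp (hB.1.eigenvalues i - 1) :=
          Finset.prod_le_prod (fun i _ => hB.eigenvalues_nonneg i) fun i _ => by
            linarith [Real.add_one_le_exp (hB.1.eigenvalues i - 1)]
      _ = 1 := by rw [← Real.exp_sum, htr, Real.exp_zero]
  rw [hDs, Matrix.det_mul, Matrix.det_mul, hD, Matrix.det_diagonal, ← Complex.ofReal_prod,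
    Complex.re_mul_ofReal, Complex.re_ofReal_mul, Finset.prod_inv_distrib] at hle
  have hp : 0 < ∏ i, √(A i i).re := Finset.prod_pos fun i _ => Real.sqrt_pos.2 (hpos i)
  have hsq : (∏ i, √(A i i).re) * (∏ i, √(A i i).re) = ∏ i, (A i i).re := by
    rw [← Finset.prod_mul_distrib]
    exact Finset.prod_congr rfl fun i _ => Real.mul_self_sqrt (hpos i).le
  rw [← hsq]
  field_simp at hle
  linarith [sq (∏ i, √(A i i).re)]

open scoped ComplexOrder in
/-- Cramer's rule and Hadamard's inequality. -/
theorem Matrix.PosSemidef.norm_sq_mul_re_det_le {n : Type*} [Fintype n] [DecidableEq n]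
    {A : Matrix n n ℂ} (hA : A.PosSemidef) (c : n → ℂ) (i : n) :
    ‖c i‖ ^ 2 * A.det.re ≤
      (∑ j, ∑ k, c j * star (c k) * A j k).re * ∏ j ∈ Finset.univ.erase i, (A j j).re := by
  -- `C A C*` has the value of the form at `c` as its `i`-th diagonal entry and `A j j` elsewhere,
  -- while `det C = c i`; Hadamard is applied to it.
  set C : Matrix n n ℂ := (1 : Matrix n n ℂ).updateRow i c with hC
  have hdet : C.det = c i := by
    rw [hC, ← Matrix.det_transpose, ← Matrix.updateCol_transpose, Matrix.transpose_one,
      ← Matrix.cramer_apply, Matrix.cramer_one]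
    rfl
  have h := (hA.mul_mul_conjTranspose_same C).re_det_le_prod_re_diag
  rw [Matrix.det_mul, Matrix.det_mul, Matrix.det_conjTranspose, hdet, mul_right_comm] at h
  have e1 : c i * star (c i) = ((‖c i‖ ^ 2 : ℝ) : ℂ) := by
    simpa using Complex.mul_conj' (c i)
  rw [e1, Complex.re_ofReal_mul, ← Finset.mul_prod_erase _ _ (Finset.mem_univ i)] at h
  refine h.trans_eq ?_
  have hrow : ∀ j, (C * A * C.conjTranspose) j j = ∑ k, ∑ l, C j k * star (C j l) * A k l := by
    intro j
    simp only [Matrix.mul_apply, Matrix.conjTranspose_apply, Finset.sum_mul]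
    rw [Finset.sum_comm]
    refine Finset.sum_congr rfl fun k _ => Finset.sum_congr rfl fun l _ => by ring
  congr 1
  · rw [hrow, hC]; simp [Matrix.updateRow_self]
  · refine Finset.prod_congr rfl fun j hj => ?_
    have hj' : j ≠ i := Finset.ne_of_mem_erase hj
    rw [hrow, hC]
    simp [Matrix.updateRow_ne hj', Matrix.one_apply]

/-- A positive semidefinite real matrix whose quadratic form is at least `1` on nonzero integral
vectors has determinant at least `n ^ (-n)`: Minkowski's theorem applied to a cube. -/
theorem Matrix.PosSemidef.one_le_card_pow_mul_det {n : Type*} [Fintype n] [DecidableEq n]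
    {G : Matrix n n ℝ} (hG : G.PosSemidef)
    (h1 : ∀ v : n → ℤ, v ≠ 0 → 1 ≤ ∑ i, ∑ j, (v i : ℝ) * v j * G i j) :
    1 ≤ (Fintype.card n : ℝ) ^ Fintype.card n * G.det := by
  have key : ∀ M : Matrix n n ℝ, M.det ≠ 0 →
      (∀ v : n → ℤ, v ≠ 0 → 1 ≤ ∑ i, (M.mulVec (fun j => (v j : ℝ)) i) ^ 2) →
      1 ≤ (Fintype.card n : ℝ) ^ Fintype.card n * M.det ^ 2 := by
    intro M hM hv
    by_contra! hlt
    rcases isEmpty_or_nonempty n with hn | hn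
    · simp at hlt
    have hcard : (0 : ℝ) < Fintype.card n := by exact_mod_cast Fintype.card_pos
    -- The open cube of half-side `n^(-1/2)` lies in the open unit ball. If `|det M| < r^n`, its
    -- preimage under `M` has volume above `2^n`, hence contains a nonzero integral point.
    set r : ℝ := (√(Fintype.card n))⁻¹ with hr
    have hr0 : 0 < r := by positivity
    have hr2 : (Fintype.card n : ℝ) * r ^ 2 = 1 := by
      rw [hr, inv_pow, Real.sq_sqrt hcard.le, mul_inv_cancel₀ hcard.ne']
    have habs : |M.det| < r ^ Fintype.card n := by
      refine abs_lt_of_sq_lt_sq ?_ (by positivity)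
      have h3 : (Fintype.card n : ℝ) ^ Fintype.card n * (r ^ Fintype.card n) ^ 2 = 1 := by
        rw [← pow_mul, mul_comm (Fintype.card n) 2, pow_mul, ← mul_pow, hr2, one_pow]
      rw [← h3] at hlt
      exact lt_of_mul_lt_mul_left hlt (by positivity)
    set S : Set (n → ℝ) := Set.pi Set.univ fun _ => Set.Ioo (-r) r with hS
    have hvolS : MeasureTheory.volume S = ENNReal.ofReal ((2 * r) ^ Fintype.card n) := by
      rw [hS, Real.volume_pi_Ioo, Finset.prod_const, Finset.card_univ,
        ← ENNReal.ofReal_pow (by linarith)]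
      congr 2; ring
    have hdetL : LinearMap.det (Matrix.toLin' M) ≠ 0 := by rwa [LinearMap.det_toLin']
    have hvol := MeasureTheory.Measure.addHaar_preimage_linearMap
      (MeasureTheory.volume : MeasureTheory.Measure (n → ℝ)) hdetL S
    have : Countable (Submodule.span ℤ (Set.range (Pi.basisFun ℝ n))).toAddSubgroup := by
      change Countable (Submodule.span ℤ (Set.range (Pi.basisFun ℝ n)))
      infer_instance
    have hfd := ZSpan.isAddFundamentalDomain' (Pi.basisFun ℝ n)
      (MeasureTheory.volume : MeasureTheory.Measure (n → ℝ))
    have hmeas : MeasureTheory.volume (ZSpan.fundamentalDomain (Pi.basisFun ℝ n)) = 1 := by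
      rw [ZSpan.fundamentalDomain_pi_basisFun, Real.volume_pi_Ico]; simp
    have hsymm : ∀ z ∈ Matrix.toLin' M ⁻¹' S, -z ∈ Matrix.toLin' M ⁻¹' S := by
      intro z hz i hi
      have := hz i hi
      rw [map_neg, Pi.neg_apply]
      exact ⟨by linarith [this.2], by linarith [this.1]⟩
    have hconv : Convex ℝ (Matrix.toLin' M ⁻¹' S) := by
      exact (convex_pi fun _ _ => convex_Ioo _ _).linear_preimage _
    have hbig : MeasureTheory.volume (ZSpan.fundamentalDomain (Pi.basisFun ℝ n)) *
        2 ^ Module.finrank ℝ (n → ℝ) < MeasureTheory.volume (Matrix.toLin' M ⁻¹' S) := by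
      rw [hvol, hvolS, hmeas, one_mul, LinearMap.det_toLin', Module.finrank_fintype_fun_eq_card,
        ← ENNReal.ofReal_mul (abs_nonneg _), ← ENNReal.ofReal_ofNat 2,
        ← ENNReal.ofReal_pow (by norm_num), ENNReal.ofReal_lt_ofReal_iff_of_nonneg (by positivity),
        abs_inv, mul_pow, ← div_eq_inv_mul, lt_div_iff₀ (abs_pos.2 hM)]
      gcongr
    obtain ⟨y, hy0, hyS⟩ :=
      MeasureTheory.exists_ne_zero_mem_lattice_of_measure_mul_two_pow_lt_measure hfd hsymm hconv hbig
    obtain ⟨v, hv'⟩ : ∃ v : n → ℤ, ∀ i, (v i : ℝ) = (y : n → ℝ) i := by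
      have := ((Pi.basisFun ℝ n).mem_span_iff_repr_mem ℤ (y : n → ℝ)).1 y.2
      choose v hv' using this
      exact ⟨v, fun i => by simpa using hv' i⟩
    have hvy : (fun i => (v i : ℝ)) = y := funext hv'
    have hv0 : v ≠ 0 := by
      rintro rfl
      apply hy0
      ext i
      simpa using (hv' i).symm
    have h4 := hv v hv0
    rw [hvy] at h4
    rw [Set.mem_preimage, Matrix.toLin'_apply, hS, Set.mem_univ_pi] at hyS
    have h5 : ∑ i, (M.mulVec (y : n → ℝ) i) ^ 2 < ∑ _i : n, r ^ 2 :=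
      Finset.sum_lt_sum_of_nonempty Finset.univ_nonempty fun i _ =>
        sq_lt_sq' (hyS i).1 (hyS i).2
    rw [Finset.sum_const, Finset.card_univ, nsmul_eq_mul, hr2] at h5
    linarith
  -- Adding `ε` times the identity makes the form definite, so that it is `Mᵀ M` with `M`
  -- invertible; then `ε → 0`.
  have hpert : ∀ ε : ℝ, 0 < ε →
      1 ≤ (Fintype.card n : ℝ) ^ Fintype.card n * (G + ε • (1 : Matrix n n ℝ)).det := by
    intro ε hε
    have hpd : (G + ε • (1 : Matrix n n ℝ)).PosDef := (Matrix.PosDef.one.smul hε).posSemidef_add hG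
    obtain ⟨M, hM⟩ : ∃ M : Matrix n n ℝ, G + ε • (1 : Matrix n n ℝ) = M.conjTranspose * M := by
      open scoped MatrixOrder in
      exact CStarAlgebra.nonneg_iff_eq_star_mul_self.1 hpd.posSemidef.nonneg
    have hdet : (G + ε • (1 : Matrix n n ℝ)).det = M.det ^ 2 := by
      rw [hM, Matrix.det_mul, Matrix.det_conjTranspose, star_trivial, sq]
    rw [hdet]
    refine key M (fun h => hpd.det_pos.ne' (by rw [hdet, h]; norm_num)) fun v hv => ?_
    have hquad : ∑ i, (M.mulVec (fun j => (v j : ℝ)) i) ^ 2 =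
        (∑ i, ∑ j, (v i : ℝ) * v j * G i j) + ε * ∑ i, (v i : ℝ) ^ 2 := by
      have h2 : ∑ i, ∑ j, (v i : ℝ) * v j * (M.conjTranspose * M) i j =
          ∑ i, (M.mulVec (fun j => (v j : ℝ)) i) ^ 2 := by
        simp only [Matrix.mulVec, dotProduct, Matrix.mul_apply, Matrix.conjTranspose_apply,
          star_trivial, sq, Finset.sum_mul, Finset.mul_sum]
        calc _ = ∑ i, ∑ k, ∑ j, (v i : ℝ) * v j * (M k i * M k j) :=
              Finset.sum_congr rfl fun i _ => Finset.sum_comm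
          _ = ∑ k, ∑ i, ∑ j, (v i : ℝ) * v j * (M k i * M k j) := Finset.sum_comm
          _ = _ := Finset.sum_congr rfl fun k _ => by
              rw [Finset.sum_comm]
              exact Finset.sum_congr rfl fun i _ => Finset.sum_congr rfl fun j _ => by ring
      rw [← h2, ← hM]
      simp only [Matrix.add_apply, mul_add, Finset.sum_add_distrib, Matrix.smul_apply,
        Matrix.one_apply, smul_eq_mul, mul_ite, mul_one, mul_zero, Finset.sum_ite_eq,
        Finset.mem_univ, if_true, Finset.mul_sum]
      congr 1
      exact Finset.sum_congr rfl fun i _ => by ring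
    rw [hquad]
    have := h1 v hv
    have : 0 ≤ ε * ∑ i, (v i : ℝ) ^ 2 := by positivity
    linarith
  have hcont : Continuous fun ε : ℝ =>
      (Fintype.card n : ℝ) ^ Fintype.card n * (G + ε • (1 : Matrix n n ℝ)).det := by fun_prop
  have hlim : Filter.Tendsto (fun ε : ℝ =>
      (Fintype.card n : ℝ) ^ Fintype.card n * (G + ε • (1 : Matrix n n ℝ)).det)
      (nhdsWithin 0 (Set.Ioi 0)) (nhds ((Fintype.card n : ℝ) ^ Fintype.card n * G.det)) := by
    have := (hcont.tendsto 0).mono_left (nhdsWithin_le_nhds (s := Set.Ioi 0))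
    simpa using this
  exact ge_of_tendsto hlim (Filter.eventually_of_mem self_mem_nhdsWithin hpert)


namespace HermLat

/-! ### Coordinates and trace on `F_ℝ` -/

section Coordinates

variable {F : Type*} [Field F]

/-- The coordinate map `F_ℝ → ℂ` at an embedding. -/
noncomputable def coord (σ : F →+* ℂ) : realSpace F →+* ℂ where
  toFun x := (x : (F →+* ℂ) → ℂ) σ
  map_one' := rfl
  map_mul' _ _ := rfl
  map_zero' := rfl
  map_add' _ _ := rfl

theorem coord_star (σ : F →+* ℂ) (x : realSpace F) : coord σ (star x) = star (coord σ x) := rfl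

theorem coord_diag (σ : F →+* ℂ) (a : F) : coord σ (diag F a) = σ a := rfl

theorem coord_algebraMap (σ : F →+* ℂ) (r : ℝ) :
    coord σ (algebraMap ℝ (realSpace F) r) = r := rfl

theorem star_coord_conjugate (σ : F →+* ℂ) (x : realSpace F) :
    star (coord (NumberField.ComplexEmbedding.conjugate σ) x) = coord σ x := x.2 σ

/-- The invariance condition ties the `σ`-coordinate only to the one at the conjugate embedding, so
it is free when `σ` is not real. -/
theorem exists_coord_eq {σ : F →+* ℂ} (hσ : NumberField.ComplexEmbedding.conjugate σ ≠ σ) (z : ℂ) :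
    ∃ a : realSpace F, coord σ a = z := by
  classical
  refine ⟨⟨fun τ => if τ = σ then z else
    if τ = NumberField.ComplexEmbedding.conjugate σ then star z else 0, fun τ => ?_⟩, if_pos rfl⟩
  have hinv := NumberField.ComplexEmbedding.involutive_conjugate F
  have h1 : NumberField.ComplexEmbedding.conjugate τ = σ ↔
      τ = NumberField.ComplexEmbedding.conjugate σ := hinv.eq_iff
  have h2 : NumberField.ComplexEmbedding.conjugate τ = NumberField.ComplexEmbedding.conjugate σ ↔
      τ = σ := hinv.injective.eq_iff
  simp only [h1, h2]
  by_cases h3 : τ = σ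
  · simp [h3, hσ.symm]
  · by_cases h4 : τ = NumberField.ComplexEmbedding.conjugate σ <;> simp [h3, h4, hσ]

theorem trace_eq_sum_coord_re [NumberField F] (x : realSpace F) :
    trace x = ∑ σ, (coord σ x).re := Complex.re_sum _ _

theorem ofReal_trace [NumberField F] (x : realSpace F) : (trace x : ℂ) = ∑ σ, coord σ x := by
  change ((∑ σ, coord σ x).re : ℂ) = _
  rw [← Complex.conj_eq_iff_re, map_sum,
    ← (NumberField.ComplexEmbedding.involutive_conjugate F).bijective.sum_comp]
  exact Finset.sum_congr rfl fun σ _ => star_coord_conjugate σ x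

end Coordinates

/-! ### Gram matrices of the components of the form -/

section Form

open scoped ComplexOrder

variable {F : Type*} [Field F] {L : Type*} [AddCommGroup L] [Module (𝓞 F) L]

theorem toVR_sum {ι : Type*} (s : Finset ι) (f : ι → L) :
    toVR F (∑ i ∈ s, f i) = ∑ i ∈ s, toVR F (f i) := by
  simp only [toVR, toV, TensorProduct.tmul_sum]

theorem toVR_smul (a : 𝓞 F) (x : L) : toVR F (a • x) = diag F (a : F) • toVR F x := by
  have h1 : toV F (a • x) = (a : F) • toV F x := by
    simp only [toV, TensorProduct.tmul_smul, TensorProduct.smul_tmul']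
    congr 1
  rw [toVR, h1, TensorProduct.tmul_smul, toVR, TensorProduct.smul_tmul', TensorProduct.smul_tmul']
  congr 1

variable (h : PosDefHermitianForm F L)

theorem form_smul_right (a : realSpace F) (x y : realSpan F L) :
    h.form x (a • y) = star a * h.form x y := by
  rw [h.conj_symm (a • y) x, h.smul_left, star_mul', ← h.conj_symm]

theorem form_add_right (x y z : realSpan F L) :
    h.form x (y + z) = h.form x y + h.form x z := by
  rw [h.conj_symm (y + z) x, h.add_left, star_add, ← h.conj_symm, ← h.conj_symm]

theorem form_sum_smul {ι : Type*} [Fintype ι] (a : ι → realSpace F) (f : ι → realSpan F L) :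
    h.form (∑ i, a i • f i) (∑ i, a i • f i) =
      ∑ i, ∑ j, a i * star (a j) * h.form (f i) (f j) := by
  have hl : ∀ y, h.form (∑ i, a i • f i) y = ∑ i, a i * h.form (f i) y := fun y => by
    have := map_sum (AddMonoidHom.mk' (fun x => h.form x y) fun x z => h.add_left x z y)
      (fun i => a i • f i) Finset.univ
    simpa only [AddMonoidHom.mk'_apply, h.smul_left] using this
  have hr : ∀ x, h.form x (∑ i, a i • f i) = ∑ i, star (a i) * h.form x (f i) := fun x => by
    have := map_sum (AddMonoidHom.mk' (fun y => h.form x y) fun y z => form_add_right h x y z)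
      (fun i => a i • f i) Finset.univ
    simpa only [AddMonoidHom.mk'_apply, form_smul_right] using this
  rw [hl]
  simp only [hr, Finset.mul_sum, mul_assoc]

/-- The Gram matrix of the `σ`-component of `h` on a family of vectors. -/
noncomputable def gram {ι : Type*} (f : ι → realSpan F L) (σ : F →+* ℂ) : Matrix ι ι ℂ :=
  Matrix.of fun i j => coord σ (h.form (f i) (f j))

theorem coord_form_sum_smul {ι : Type*} [Fintype ι] (a : ι → realSpace F) (f : ι → realSpan F L)
    (σ : F →+* ℂ) :
    coord σ (h.form (∑ i, a i • f i) (∑ i, a i • f i)) =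
      ∑ i, ∑ j, coord σ (a i) * star (coord σ (a j)) * gram h f σ i j := by
  simp only [form_sum_smul, map_sum, map_mul, coord_star, gram, Matrix.of_apply]

/-- Nonnegativity of `h` can only be tested with coefficients in `F_ℝ`. At a non-real `σ` these
realise every complex vector; at a real `σ` they are real, but there the Gram matrix is real too,
and the real and imaginary parts of `c` contribute separately. -/
theorem gram_posSemidef {ι : Type*} [Fintype ι] (f : ι → realSpan F L) (σ : F →+* ℂ) :
    (gram h f σ).PosSemidef := by
  have hH : (gram h f σ).IsHermitian := by
    ext i j
    simp only [Matrix.conjTranspose_apply, gram, Matrix.of_apply, ← coord_star, ← h.conj_symm]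
  refine .of_dotProduct_mulVec_nonneg hH fun c => Complex.le_def.2 ⟨?_, ?_⟩
  swap
  · exact (hH.im_star_dotProduct_mulVec_self c).symm
  have hexp : star c ⬝ᵥ (gram h f σ).mulVec c =
      ∑ i, ∑ j, star (c i) * c j * gram h f σ i j := by
    simp only [dotProduct, Matrix.mulVec, Finset.mul_sum, Pi.star_apply]
    exact Finset.sum_congr rfl fun i _ => Finset.sum_congr rfl fun j _ => by ring
  rw [hexp]
  by_cases hσ : NumberField.ComplexEmbedding.conjugate σ = σ
  · have him : ∀ i j, (gram h f σ i j).im = 0 := fun i j => by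
      have := star_coord_conjugate σ (h.form (f i) (f j))
      rw [hσ] at this
      exact Complex.conj_eq_iff_im.1 this
    have key : ∀ r : ι → ℝ, 0 ≤ ∑ i, ∑ j, r i * r j * (gram h f σ i j).re := fun r => by
      have h1 : 0 ≤ (coord σ (h.form (∑ i, algebraMap ℝ (realSpace F) (r i) • f i)
        (∑ i, algebraMap ℝ (realSpace F) (r i) • f i))).re := h.nonneg _ σ
      rw [coord_form_sum_smul] at h1
      simpa [coord_algebraMap] using h1
    have h2 := add_nonneg (key fun i => (c i).re) (key fun i => (c i).im)
    refine h2.trans_eq ?_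
    simp only [Complex.re_sum, ← Finset.sum_add_distrib]
    refine Finset.sum_congr rfl fun i _ => Finset.sum_congr rfl fun j _ => ?_
    simp [Complex.mul_re, him]
    ring
  · choose a ha using fun i => exists_coord_eq hσ (star (c i))
    have h1 : 0 ≤ (coord σ (h.form (∑ i, a i • f i) (∑ i, a i • f i))).re := h.nonneg _ σ
    rw [coord_form_sum_smul] at h1
    simp only [ha, star_star] at h1
    exact h1

theorem re_coord_form_nonneg (x : realSpan F L) (σ : F →+* ℂ) :
    0 ≤ (coord σ (h.form x x)).re := h.nonneg x σ

theorem re_det_gram_nonneg {ι : Type*} [Fintype ι] [DecidableEq ι] (f : ι → realSpan F L)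
    (σ : F →+* ℂ) : 0 ≤ (gram h f σ).det.re :=
  (Complex.le_def.1 (gram_posSemidef h f σ).det_nonneg).1

theorem ofReal_re_det_gram {ι : Type*} [Fintype ι] [DecidableEq ι] (f : ι → realSpan F L)
    (σ : F →+* ℂ) : ((gram h f σ).det.re : ℂ) = (gram h f σ).det := by
  apply Complex.ext <;> simp [← (Complex.le_def.1 (gram_posSemidef h f σ).det_nonneg).2]

variable [NumberField F]

theorem quadForm_eq_sum (x : realSpan F L) :
    quadForm h x = ∑ σ, (coord σ (h.form x x)).re := trace_eq_sum_coord_re _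

theorem quadForm_nonneg (x : realSpan F L) : 0 ≤ quadForm h x := by
  rw [quadForm_eq_sum]
  exact Finset.sum_nonneg fun σ _ => re_coord_form_nonneg h x σ

theorem re_coord_form_le_quadForm (x : realSpan F L) (σ : F →+* ℂ) :
    (coord σ (h.form x x)).re ≤ quadForm h x := by
  rw [quadForm_eq_sum]
  exact Finset.single_le_sum (f := fun σ => (coord σ (h.form x x)).re)
    (fun σ _ => re_coord_form_nonneg h x σ) (Finset.mem_univ σ)

theorem minValue_le_quadForm {x : L} (hx : x ≠ 0) : minValue h ≤ quadForm h (toVR F x) :=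
  csInf_le ⟨0, by rintro _ ⟨y, -, rfl⟩; exact quadForm_nonneg h _⟩ ⟨x, hx, rfl⟩

theorem quadForm_sum_smul {ι : Type*} [Fintype ι] (r : ι → ℝ) (f : ι → realSpan F L) :
    quadForm h (∑ i, algebraMap ℝ (realSpace F) (r i) • f i) =
      ∑ i, ∑ j, r i * r j * trace (h.form (f i) (f j)) := by
  simp only [quadForm_eq_sum, coord_form_sum_smul, coord_algebraMap, trace_eq_sum_coord_re]
  simp only [Complex.re_sum, Finset.mul_sum]
  rw [Finset.sum_comm]
  refine Finset.sum_congr rfl fun i _ => ?_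
  rw [Finset.sum_comm]
  refine Finset.sum_congr rfl fun j _ => Finset.sum_congr rfl fun σ _ => ?_
  simp [gram]

end Form

/-! ### The Gram matrix over `ℤ` and the lower bound for the determinants -/

section IntegralGram

open scoped Kronecker

variable {F : Type*} [Field F] [NumberField F] {L : Type*} [AddCommGroup L] [Module (𝓞 F) L]
  (h : PosDefHermitianForm F L) {ι : Type*} [Fintype ι]

/-- An integral basis of `F`, indexed by the embeddings. -/
noncomputable def intBasis (κ : F →+* ℂ) : 𝓞 F :=
  NumberField.RingOfIntegers.basis F (NumberField.equivReindex F κ)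

/-- The Gram matrix of the real quadratic form on the `ℤ`-basis `ω_κ e_i` of `L`. -/
noncomputable def intGram (e : ι → L) : Matrix (ι × (F →+* ℂ)) (ι × (F →+* ℂ)) ℝ :=
  Matrix.of fun p q => trace (h.form (toVR F (intBasis p.2 • e p.1)) (toVR F (intBasis q.2 • e q.1)))

theorem intGram_posSemidef (e : ι → L) : (intGram h e).PosSemidef := by
  refine .of_dotProduct_mulVec_nonneg ?_ fun c => ?_
  · ext p q
    simp only [Matrix.conjTranspose_apply, star_trivial, intGram, Matrix.of_apply,
      trace_eq_sum_coord_re]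
    refine Finset.sum_congr rfl fun σ _ => ?_
    rw [h.conj_symm, coord_star]
    simp
  · refine (quadForm_nonneg h (∑ p : ι × (F →+* ℂ),
      algebraMap ℝ (realSpace F) (c p) • toVR F (intBasis p.2 • e p.1))).trans_eq ?_
    rw [quadForm_sum_smul]
    simp only [dotProduct, Matrix.mulVec, Finset.mul_sum, star_trivial, intGram, Matrix.of_apply]
    exact Finset.sum_congr rfl fun i _ => Finset.sum_congr rfl fun j _ => by ring

/-- The matrix factors as `K · diag(H σ) · K*` with `K = 1 ⊗ W`, where `W` holds the conjugates of
the integral basis and `|det W|² = |D_F|`. -/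
theorem det_intGram [DecidableEq ι] [DecidableEq (F →+* ℂ)] (e : ι → L) :
    (intGram h e).det = |(NumberField.discr F : ℝ)| ^ Fintype.card ι *
      ∏ σ, (gram h (fun i => toVR F (e i)) σ).det.re := by
  set W := NumberField.basisMatrix F
  set K : Matrix (ι × (F →+* ℂ)) (ι × (F →+* ℂ)) ℂ := (1 : Matrix ι ι ℂ) ⊗ₖ W with hK
  have hmat : (intGram h e).map ((↑) : ℝ → ℂ) =
      K * Matrix.blockDiagonal (gram h fun i => toVR F (e i)) * K.conjTranspose := by
    ext ⟨i, κ⟩ ⟨j, l⟩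
    simp only [Matrix.map_apply, intGram, Matrix.of_apply, ofReal_trace, toVR_smul, h.smul_left,
      form_smul_right, map_mul, coord_star, coord_diag]
    simp only [Matrix.mul_apply, Fintype.sum_prod_type, hK, Matrix.kroneckerMap_apply,
      Matrix.blockDiagonal_apply, Matrix.conjTranspose_apply, Matrix.one_apply]
    simp [apply_ite (starRingEnd ℂ), gram, W, intBasis, NumberField.RingOfIntegers.coe_eq_algebraMap]
    exact Finset.sum_congr rfl fun σ _ => by ring
  have hW : W.det * star W.det = ((|(NumberField.discr F : ℝ)| : ℝ) : ℂ) := by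
    have h1 := NumberField.discr_eq_basisMatrix_det_sq F
    have h2 := congrArg norm h1
    rw [norm_pow] at h2
    have h3 : ‖W.det‖ ^ 2 = |(NumberField.discr F : ℝ)| := by
      rw [← h2]; simp
    rw [← h3]
    simpa using Complex.mul_conj' W.det
  have hdet := congrArg Matrix.det hmat
  rw [Matrix.det_mul, Matrix.det_mul, Matrix.det_conjTranspose, Matrix.det_blockDiagonal, hK,
    Matrix.det_kronecker, Matrix.det_one, one_pow, one_mul, mul_right_comm, star_pow, ← mul_pow,
    hW, Finset.prod_congr rfl fun σ _ => (ofReal_re_det_gram h _ σ).symm] at hdet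
  have h4 : ((intGram h e).map ((↑) : ℝ → ℂ)).det = ((intGram h e).det : ℂ) :=
    (RingHom.map_det Complex.ofRealHom _).symm
  rw [h4] at hdet
  exact_mod_cast hdet

theorem sum_smul_intBasis_smul_ne_zero (e : Module.Basis ι (𝓞 F) L) {v : ι × (F →+* ℂ) → ℤ}
    (hv : v ≠ 0) : ∑ p : ι × (F →+* ℂ), ((v p : 𝓞 F) * intBasis p.2) • e p.1 ≠ 0 := by
  intro h0
  apply hv
  have hrepr : ∑ i, (∑ κ, (v (i, κ) : 𝓞 F) * intBasis κ) • e i = 0 := by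
    rw [← h0, Fintype.sum_prod_type]
    exact Finset.sum_congr rfl fun i _ => Finset.sum_smul
  have h1 := Fintype.linearIndependent_iff.1 e.linearIndependent _ hrepr
  have hω : LinearIndependent ℤ (intBasis (F := F)) :=
    (NumberField.RingOfIntegers.basis F).linearIndependent.comp _
      (NumberField.equivReindex F).injective
  ext ⟨i, κ⟩
  refine Fintype.linearIndependent_iff.1 hω (fun κ => v (i, κ)) ?_ κ
  rw [← h1 i]
  exact Finset.sum_congr rfl fun κ _ => zsmul_eq_mul _ _

theorem one_le_mul_prod_det_gram [DecidableEq ι] (e : Module.Basis ι (𝓞 F) L) (hmin : minValue h = 1) :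
    1 ≤ (Fintype.card ι * Module.finrank ℚ F : ℝ) ^ (Fintype.card ι * Module.finrank ℚ F) *
      (|(NumberField.discr F : ℝ)| ^ Fintype.card ι *
        ∏ σ, (gram h (fun i => toVR F (e i)) σ).det.re) := by
  classical
  have h1 := (intGram_posSemidef h e).one_le_card_pow_mul_det fun v hv => ?_
  · rwa [det_intGram, Fintype.card_prod, NumberField.Embeddings.card, Nat.cast_mul] at h1
  · have h2 := minValue_le_quadForm h (sum_smul_intBasis_smul_ne_zero e hv)
    rw [hmin] at h2
    refine h2.trans_eq ?_
    have h3 : toVR F (∑ p : ι × (F →+* ℂ), ((v p : 𝓞 F) * intBasis p.2) • e p.1) =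
        ∑ p, algebraMap ℝ (realSpace F) (v p : ℝ) • toVR F (intBasis p.2 • e p.1) := by
      rw [toVR_sum]
      refine Finset.sum_congr rfl fun p _ => ?_
      rw [mul_smul, toVR_smul]
      congr 1
      simp
    rw [h3, quadForm_sum_smul]
    rfl

end IntegralGram

end HermLat

/-! ### The coordinate bound -/

open HermLat in
theorem proposition5p1 {F : Type*} [Field F] [NumberField F]
    (hF : Module.finrank ℚ F ≠ 1)
    {L : Type*} [AddCommGroup L] [Module (𝓞 F) L] [Module.Free (𝓞 F) L] [Module.Finite (𝓞 F) L]
    (N : ℕ) (hN : 5 ≤ N) (hrank : Module.finrank (𝓞 F) L = N)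
    (h : HermLat.PosDefHermitianForm F L) (hwr : HermLat.IsWellRounded h)
    (e : Module.Basis (Fin N) (𝓞 F) L)
    (he : ∀ i : Fin N, HermLat.hnorm h (HermLat.toVR F (e i)) ≤ HermLat.boundB F N)
    (x : L) (hx : x ∈ HermLat.minVectors h) (i : Fin N) :
    ∑ σ : F →+* ℂ, ‖σ (e.repr x i : F)‖ ^ 2 ≤ HermLat.boundT F N := by
  classical
  set d := Module.finrank ℚ F with hd
  set B := boundB F N with hB
  set D : ℝ := |(NumberField.discr F : ℝ)| with hD
  have hd0 : 0 < d := Module.finrank_pos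
  have hd1 : (1 : ℝ) ≤ d := by exact_mod_cast hd0
  have hD1 : 1 ≤ D := by
    rw [hD, ← Int.cast_abs]
    exact_mod_cast Int.one_le_abs (NumberField.discr_ne_zero F)
  have hB0 : 0 ≤ B := by rw [hB, boundB]; positivity
  set H := gram h fun j => toVR F (e j) with hH
  have hnn : ∀ σ j, 0 ≤ (H σ j j).re := fun σ j => re_coord_form_nonneg h _ σ
  have hle : ∀ σ j, (H σ j j).re ≤ B ^ 2 := fun σ j =>
    (re_coord_form_le_quadForm h _ σ).trans ((Real.sqrt_le_iff.1 (he j)).2)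
  have hdet0 : ∀ σ, 0 ≤ (H σ).det.re := re_det_gram_nonneg h _
  have hdet : ∀ σ, (H σ).det.re ≤ (B ^ 2) ^ N := fun σ =>
    (gram_posSemidef h (fun j => toVR F (e j)) σ).re_det_le_prod_re_diag.trans <|
      (Finset.prod_le_prod (fun j _ => hnn σ j) fun j _ => hle σ j).trans_eq (by simp)
  have hqx : quadForm h (toVR F x) = 1 := hx.trans hwr.1
  have hcramer : ∀ σ : F →+* ℂ, ‖σ (e.repr x i : F)‖ ^ 2 * (H σ).det.re ≤ (B ^ 2) ^ (N - 1) := by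
    intro σ
    have h1 := (gram_posSemidef h (fun j => toVR F (e j)) σ).norm_sq_mul_re_det_le (fun j => σ (e.repr x j : F)) i
    have h2 : toVR F x = ∑ j, diag F (e.repr x j : F) • toVR F (e j) := by
      conv_lhs => rw [← e.sum_repr x, toVR_sum]
      simp only [toVR_smul]
    have h3 := coord_form_sum_smul h (fun j => diag F (e.repr x j : F)) (fun j => toVR F (e j)) σ
    rw [← h2] at h3
    simp only [coord_diag] at h3
    rw [← h3] at h1
    have h4 : ∏ j ∈ Finset.univ.erase i, (H σ j j).re ≤ (B ^ 2) ^ (N - 1) :=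
      (Finset.prod_le_prod (fun j _ => hnn σ j) fun j _ => hle σ j).trans_eq (by simp)
    calc _ ≤ _ := h1
      _ ≤ 1 * (B ^ 2) ^ (N - 1) := by
        refine mul_le_mul ?_ h4 (Finset.prod_nonneg fun j _ => hnn σ j) zero_le_one
        exact hqx ▸ re_coord_form_le_quadForm h _ σ
      _ = _ := one_mul _
  set P := ∏ σ, (H σ).det.re with hP
  have hPle : ∀ σ : F →+* ℂ, ‖σ (e.repr x i : F)‖ ^ 2 * P ≤ B ^ (2 * (N * d - 1)) := by
    intro σ
    rw [hP, ← Finset.mul_prod_erase _ _ (Finset.mem_univ σ), ← mul_assoc]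
    have h4 : ∏ τ ∈ Finset.univ.erase σ, (H τ).det.re ≤ ((B ^ 2) ^ N) ^ (d - 1) :=
      (Finset.prod_le_prod (fun τ _ => hdet0 τ) fun τ _ => hdet τ).trans_eq (by
        rw [Finset.prod_const, Finset.card_erase_of_mem (Finset.mem_univ σ), Finset.card_univ,
          NumberField.Embeddings.card])
    refine (mul_le_mul (hcramer σ) h4 (Finset.prod_nonneg fun τ _ => hdet0 τ)
      (by positivity)).trans_eq ?_
    rw [← pow_mul, ← pow_mul, ← pow_mul, ← pow_add]
    congr 1
    -- The exponents add up as `(N - 1) + N(d - 1) = Nd - 1`; passing to predecessors removes the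
    -- truncated subtractions.
    obtain ⟨d', hd'⟩ := Nat.exists_eq_succ_of_ne_zero hd0.ne'
    obtain ⟨N', hN'⟩ := Nat.exists_eq_succ_of_ne_zero (by omega : N ≠ 0)
    rw [hd', hN', Nat.succ_sub_one, Nat.succ_sub_one,
      show N'.succ * d'.succ - 1 = N' + N'.succ * d' by rw [Nat.mul_succ]; omega]
    ring
  have hmink := one_le_mul_prod_det_gram h e hwr.1
  rw [Fintype.card_fin, ← hd, ← hD, ← hH, ← hP] at hmink
  have hterm : ∀ σ : F →+* ℂ, ‖σ (e.repr x i : F)‖ ^ 2 ≤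
      (N * d : ℝ) ^ (N * d) * D ^ N * B ^ (2 * (N * d - 1)) := by
    intro σ
    calc ‖σ (e.repr x i : F)‖ ^ 2
        -- Multiplying by the Minkowski quantity, which is at least `1`, replaces a division by `P`.
        ≤ ‖σ (e.repr x i : F)‖ ^ 2 * ((N * d : ℝ) ^ (N * d) * (D ^ N * P)) :=
          le_mul_of_one_le_right (by positivity) hmink
      _ = (N * d : ℝ) ^ (N * d) * D ^ N * (‖σ (e.repr x i : F)‖ ^ 2 * P) := by ring
      _ ≤ _ := mul_le_mul_of_nonneg_left (hPle σ) (by positivity)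
  -- The exponent `Nd` comes from Minkowski and the extra `1` from summing over the `d` embeddings.
  have hpow : (d : ℝ) ^ (N * d + 1) ≤ (d : ℝ) ^ ((3 / 2 : ℝ) * N * d + 1) := by
    rw [← Real.rpow_natCast]
    refine Real.rpow_le_rpow_of_exponent_le hd1 ?_
    push_cast
    nlinarith [mul_nonneg (Nat.cast_nonneg (α := ℝ) N) (Nat.cast_nonneg (α := ℝ) d)]
  calc ∑ σ : F →+* ℂ, ‖σ (e.repr x i : F)‖ ^ 2
      ≤ ∑ _σ : F →+* ℂ, (N * d : ℝ) ^ (N * d) * D ^ N * B ^ (2 * (N * d - 1)) :=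
        Finset.sum_le_sum fun σ _ => hterm σ
    _ = (N : ℝ) ^ (N * d) * (d : ℝ) ^ (N * d + 1) * B ^ (2 * (N * d - 1)) * D ^ N := by
        rw [Finset.sum_const, Finset.card_univ, NumberField.Embeddings.card, nsmul_eq_mul, ← hd,
          mul_pow]
        ring
    _ ≤ (N : ℝ) ^ (N * d) * (d : ℝ) ^ ((3 / 2 : ℝ) * N * d + 1) * B ^ (2 * (N * d - 1)) *
          D ^ (2 * N) := by
        have h2 : D ^ N ≤ D ^ (2 * N) := pow_le_pow_right₀ hD1 (by omega)
        gcongr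
    _ = boundT F N := rfl
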